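/- Let $H(\omega_1)$ be the set of all sets whose transitive closure is countable. Call a set $M\subseteq H(\omega_1)$ a *model* if $M$ is transitive and $(M,\in)$ satisfies all axioms of ZF except the power set axiom. For $s,b\subseteq\omega$, say that $s$ *splits* $b$ if $b\cap s$ and $b\setminus s$ are both infinite. For an ordinal $\lambda$, $2^{<\lambda}$ (respectively $2^{\le\lambda}$) is the set of functions into $\{0,1\}$ whose domain is an ordinal $<\lambda$ (respectively $\le\lambda$). For such a function $\sigma$ let $\sigma^\dagger=\sigma$ if $\mathrm{dom}(\sigma)$ is not a successor ordinal, and otherwise let $\sigma^\dagger$ be the function with the same domain that differs from $\sigma$ exactly at the maximum of $\mathrm{dom}(\sigma)$. A sequence $\langle a_\alpha:\alpha<\mu\rangle$ of subsets of $\omega$ is *coherent* if for all $\alpha\le\beta<\mu$ there is a finite $F\subseteq\alpha$ with $a_\alpha\cap a_\beta\subseteq\bigcup_{\gamma\in F}a_\gamma$ or $a_\alpha\subseteq a_\beta\cup\bigcup_{\gamma\in F}a_\gamma$; it is *proper* if no $a_\beta$ is contained in the union of finitely many $a_\xi$ with $\xi<\beta$. A *$\mathbb T$-algebra on $\Gamma$*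 is a family $\langle a_\sigma:\sigma\in\Gamma\rangle$ of subsets of $\omega$ such that for some ordinal $\lambda$: 1. $\Gamma\subseteq 2^{<\lambda}$ is closed under restriction to smaller ordinals; 2. $\sigma^\dagger\in\Gamma$ for every $\sigma\in\Gamma$; 3. $a_\sigma=\emptyset$ whenever $\sigma\in\Gamma$ and $\mathrm{dom}(\sigma)$ is not a successor ordinal; 4. $a_{\sigma^\dagger}=\omega\setminus a_\sigma$ whenever $\sigma\in\Gamma$ and $\mathrm{dom}(\sigma)$ is a successor ordinal; 5. for every $x\in2^{\le\lambda}$, the sequence of the sets $a_{x\restriction(\alpha+1)}$, indexed by those $\alpha<\mathrm{dom}(x)$ with $x\restriction(\alpha+1)\in\Gamma$, is coherent and proper. Its *Stone space* is the space of ultrafilters on the Boolean subalgebra of $\mathcal P(\omega)$ generated by $\{a_\sigma:\sigma\in\Gamma\}$, with the Stone topology. **Proposition.** Suppose that $H(\omega_1)=\bigcup_{\xi<\omega_1}M_\xi$, where $\langle M_\xi:\xi<\omega_1\rangle$ is a $\subseteq$-increasing chain of models such that for each $\xi<\omega_1$ there is a subset of $\omega$ that splits every infinite subset of $\omega$ belonging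 to $M_\xi$. Then there is a $\mathbb T$-algebra on $2^{<\omega_1}$ whose Stone space has no converging sequences, that is, no sequence of pairwise distinct points of the Stone space converges. -/

import Mathlib

open scoped Ordinal

namespace TAlg

/-! ### Models of ZF without power set inside `H(ω₁)` -/

/-- `H(ω₁)`: the sets whose transitive closure is countable. The transitive closure of `x` consists
of the `y` with `y ∈ y₁ ∈ ⋯ ∈ yₙ ∈ x` for some `n ≥ 0`. -/
def HOmegaOne : Set ZFSet.{0} :=
  {x | {y : ZFSet.{0} | Relation.TransGen (fun u v : ZFSet.{0} => u ∈ v) y x}.Countable}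

/-- The relation symbols of the language of set theory: one binary symbol. -/
inductive SetRel : ℕ → Type
  | mem : SetRel 2

/-- The first-order language of set theory. -/
def setLang : FirstOrder.Language := ⟨fun _ => Empty, SetRel⟩

/-- The structure `(M, ∈)`. -/
instance memStructure (M : Set ZFSet.{0}) : setLang.Structure M where
  funMap := fun f _ => f.elim
  RelMap := fun r =>
    match r with
    | SetRel.mem => fun v => (v 0 : ZFSet.{0}) ∈ (v 1 : ZFSet.{0})

/-- `(M, ∈)` is a model of all the axioms of ZF except the power set axiom. In the two schemes `φ`
is an arbitrary first-order formula of set theory with free variables indexed by `ℕ`; variable `0`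
(and variable `1` in replacement) is the distinguished one, and the values `p i` of the other
variables are parameters. All quantifiers, including those in `φ`, range over `M`. -/
structure ModelsZFWithoutPower (M : Set ZFSet.{0}) : Prop where
  extensionality : ∀ x y : M, (∀ z : M, z.1 ∈ x.1 ↔ z.1 ∈ y.1) → x = y
  foundation : ∀ x : M, (∃ y : M, y.1 ∈ x.1) → ∃ y : M, y.1 ∈ x.1 ∧ ∀ z : M, z.1 ∈ y.1 → z.1 ∉ x.1
  pairing : ∀ x y : M, ∃ z : M, ∀ w : M, w.1 ∈ z.1 ↔ w = x ∨ w = y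
  union : ∀ x : M, ∃ u : M, ∀ z : M, z.1 ∈ u.1 ↔ ∃ y : M, y.1 ∈ x.1 ∧ z.1 ∈ y.1
  infinity : ∃ w : M, (∃ e : M, e.1 ∈ w.1 ∧ ∀ z : M, z.1 ∉ e.1) ∧
    ∀ x : M, x.1 ∈ w.1 → ∃ y : M, y.1 ∈ w.1 ∧ ∀ z : M, z.1 ∈ y.1 ↔ z.1 ∈ x.1 ∨ z = x
  separation : ∀ (φ : setLang.Formula ℕ) (p : ℕ → M) (a : M), ∃ b : M, ∀ x : M,
    x.1 ∈ b.1 ↔ x.1 ∈ a.1 ∧ φ.Realize (Function.update p 0 x)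
  replacement : ∀ (φ : setLang.Formula ℕ) (p : ℕ → M) (a : M),
    (∀ x : M, x.1 ∈ a.1 →
      ∃! y : M, φ.Realize (Function.update (Function.update p 0 x) 1 y)) →
    ∃ b : M, ∀ x : M, x.1 ∈ a.1 →
      ∃ y : M, y.1 ∈ b.1 ∧ φ.Realize (Function.update (Function.update p 0 x) 1 y)

/-- `M` is a transitive class: elements of elements of `M` belong to `M`. -/
def IsTransitiveSet (M : Set ZFSet.{0}) : Prop :=
  ∀ x ∈ M, ∀ y ∈ x, y ∈ M

/-- `s` splits `b`: both `b ∩ s` and `b \ s` are infinite. -/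
def Splits (s b : ZFSet.{0}) : Prop :=
  {n | n ∈ b ∩ s}.Infinite ∧ {n | n ∈ b \ s}.Infinite

/-! ### Binary sequences of ordinal length -/

/-- A function from an ordinal (the set of the smaller ordinals) to `2 = {0, 1}`. -/
structure BinSeq where
  length : Ordinal.{0}
  val : Set.Iio length → Bool

/-- The restriction of `x` to `α`, as a function on `α ∩ dom x`. -/
noncomputable def BinSeq.restrict (x : BinSeq) (α : Ordinal.{0}) : BinSeq where
  length := min α x.length
  val := fun i => x.val ⟨i.1, lt_of_lt_of_le i.2 (min_le_right α x.length)⟩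

/-- `σ†`: if the length of `σ` is a successor, change the last value of `σ`;
otherwise leave `σ` as it is. -/
noncomputable def BinSeq.dagger (σ : BinSeq) : BinSeq where
  length := σ.length
  val := open Classical in
    fun i => if i.1 + 1 = σ.length then !(σ.val i) else σ.val i

/-- The tree `2^{<λ}`. -/
def tree (l : Ordinal.{0}) : Set BinSeq := {σ | σ.length < l}

/-! ### `𝕋`-algebras -/

/-- The sequence `⟨a α : α ∈ I⟩` of subsets of `ω` is coherent (`I` an initial segment of the
ordinals). -/
def IsCoherent (I : Set Ordinal.{0}) (a : Ordinal.{0} → Set ℕ) : Prop :=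
  ∀ α ∈ I, ∀ β ∈ I, α ≤ β → ∃ F : Finset Ordinal.{0}, (∀ γ ∈ F, γ < α) ∧
    (a α ∩ a β ⊆ ⋃ γ ∈ F, a γ ∨ a α ⊆ a β ∪ ⋃ γ ∈ F, a γ)

/-- The sequence `⟨a α : α ∈ I⟩` is proper (`I` an initial segment of the ordinals): no `a β` lies
in the ideal generated by the earlier terms, i.e. is covered by finitely many of them. -/
def IsProper (I : Set Ordinal.{0}) (a : Ordinal.{0} → Set ℕ) : Prop :=
  ∀ β ∈ I, ¬ ∃ F : Finset Ordinal.{0}, (∀ γ ∈ F, γ < β) ∧ a β ⊆ ⋃ γ ∈ F, a γ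

/-- The family `⟨a σ : σ ∈ Γ⟩` of subsets of `ω` is a `𝕋`-algebra (the values of `a` outside `Γ`
are irrelevant). -/
def IsTAlgebra (Γ : Set BinSeq) (a : BinSeq → Set ℕ) : Prop :=
  ∃ l : Ordinal.{0},
    -- `Γ` is a downward closed subtree of `2^{<l}`
    Γ ⊆ tree l ∧ (∀ σ ∈ Γ, ∀ α ≤ σ.length, σ.restrict α ∈ Γ) ∧
    -- `Γ` is twinned
    (∀ σ ∈ Γ, σ.dagger ∈ Γ) ∧
    (∀ σ ∈ Γ, (¬ ∃ α, σ.length = α + 1) → a σ = ∅) ∧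
    (∀ σ ∈ Γ, (∃ α, σ.length = α + 1) → a σ.dagger = (a σ)ᶜ) ∧
    -- along every `x ∈ 2^{≤l}` the sets `a (x ↾ (α + 1))` form a proper coherent sequence
    (∀ x : BinSeq, x.length ≤ l →
      IsCoherent {α | α < x.length ∧ x.restrict (α + 1) ∈ Γ} (fun α => a (x.restrict (α + 1))) ∧
      IsProper {α | α < x.length ∧ x.restrict (α + 1) ∈ Γ} (fun α => a (x.restrict (α + 1))))

/-- The Boolean subalgebra of `𝒫(ω)` generated by `{a σ : σ ∈ Γ}`. -/
def generatedAlgebra (Γ : Set BinSeq) (a : BinSeq → Set ℕ) : BooleanSubalgebra (Set ℕ) :=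
  BooleanSubalgebra.closure (a '' Γ)

/-! ### Stone spaces -/

/-- The Stone space of a Boolean algebra `B`: its points are the ultrafilters on `B`. -/
structure StoneSpace (B : Type*) [BooleanAlgebra B] where
  carrier : Set B
  top_mem : ⊤ ∈ carrier
  bot_notMem : ⊥ ∉ carrier
  inf_mem : ∀ b ∈ carrier, ∀ c ∈ carrier, b ⊓ c ∈ carrier
  mem_of_le : ∀ b ∈ carrier, ∀ c, b ≤ c → c ∈ carrier
  mem_or_compl_mem : ∀ b, b ∈ carrier ∨ bᶜ ∈ carrier

/-- The Stone topology, with the sets `{U | b ∈ U}` for `b ∈ B` as a base. -/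
instance stoneTopology (B : Type*) [BooleanAlgebra B] : TopologicalSpace (StoneSpace B) :=
  TopologicalSpace.generateFrom {V | ∃ b : B, V = {U : StoneSpace B | b ∈ U.carrier}}

/-- `X` has no (nontrivial) converging sequences: no sequence of distinct points converges. -/
def HasNoConvergingSequences (X : Type*) [TopologicalSpace X] : Prop :=
  ∀ u : ℕ → X, Function.Injective u →
    ∀ x : X, ¬ Filter.Tendsto u Filter.atTop (nhds x)

end TAlg

namespace TAlg

/-! The sets are chosen by recursion along the tree. Along a branch, coherence makes the filter
generated by `a β` and the complements of the earlier terms decide every term; call it U_β. A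
continuation at level α must be decided by every U_β with β < α, and neither it nor its complement
may lie in the ideal generated by the earlier terms.

If that ideal has no largest element (`exists_isStep`), the countably many terms are disjointified
into pieces c_k. Each U_β concentrates on a single piece c_{J β}, so for any S ⊆ ω the union A of
the c_k with k ∈ S is decided by U_β according to whether J β ∈ S. If the U_{t n} eventually omit
each term, then J(t n) → ∞, and an S splitting {J(t n)} makes A oscillate along the sequence. Such
an S exists for all t coded in M_α at once: by separation the images {J(t n)} lie in one later model
that contains J, and a splitting set for that model serves (`exists_splitting_families`). If the
ideal has a largest element, its complement is kept infinite, so it can be halved.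

Now let u n → V with u n ≠ V. The sets omitted by V form a branch z, and along z the point u n acts
as U_{t n}, where t n is the first level with z(t n) ∈ u n. At a countable limit level above all t
n, late enough for t to be captured, properness rules out a largest element of the ideal; the set
chosen there oscillates along u, but V decides it (`not_tendsto_of_forall_ne`). -/

/-! ### Codes for numbers and countable ordinals in H(ω₁) -/

theorem ofNat_eq_toZFSet (n : ℕ) :
    ZFSet.mk (PSet.ofNat n) = (n : Ordinal.{0}).toZFSet := by
  induction n with
  | zero => simp only [Nat.cast_zero, Ordinal.toZFSet_zero]; rfl
  | succ n ih =>
    rw [Nat.cast_succ, Ordinal.toZFSet_add_one, ← ih]; rfl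

theorem mem_omega_iff {x : ZFSet.{0}} :
    x ∈ ZFSet.omega.{0} ↔ ∃ n : ℕ, (n : Ordinal.{0}).toZFSet = x := by
  constructor
  · induction x using Quotient.inductionOn with
    | _ x =>
      rintro ⟨⟨n⟩, hn⟩
      exact ⟨n, by rw [← ofNat_eq_toZFSet]; exact (Quotient.sound hn).symm⟩
  · rintro ⟨n, rfl⟩
    rw [← ofNat_eq_toZFSet]
    exact ⟨⟨n⟩, PSet.Equiv.rfl⟩

theorem mem_HOmegaOne_of_countable {x : ZFSet.{0}} (hc : {y | y ∈ x}.Countable)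
    (hx : ∀ y ∈ x, y ∈ HOmegaOne) : x ∈ HOmegaOne := by
  have : {y : ZFSet.{0} | Relation.TransGen (fun u v : ZFSet.{0} => u ∈ v) y x} ⊆
      {y | y ∈ x} ∪ ⋃ z ∈ {y | y ∈ x},
        {y : ZFSet.{0} | Relation.TransGen (fun u v : ZFSet.{0} => u ∈ v) y z} := by
    intro y hy
    rcases Relation.TransGen.tail'_iff.1 hy with ⟨z, hyz, hz⟩
    rcases Relation.reflTransGen_iff_eq_or_transGen.1 hyz with h | h
    · exact Or.inl (h ▸ hz)
    · exact Or.inr (Set.mem_biUnion (x := z) hz h)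
  exact (hc.union (hc.biUnion fun z hz => hx z hz)).mono this

theorem range_mem_HOmegaOne {ι : Type} [Countable ι] {f : ι → ZFSet.{0}}
    (hf : ∀ i, f i ∈ HOmegaOne) : ZFSet.range f ∈ HOmegaOne := by
  refine mem_HOmegaOne_of_countable ?_ ?_
  · exact (Set.countable_range f).mono fun y hy => by simpa using hy
  · intro y hy
    obtain ⟨i, rfl⟩ := ZFSet.mem_range.1 hy
    exact hf i

theorem pair_mem_HOmegaOne {x y : ZFSet.{0}} (hx : x ∈ HOmegaOne) (hy : y ∈ HOmegaOne) :
    ({x, y} : ZFSet.{0}) ∈ HOmegaOne := by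
  refine mem_HOmegaOne_of_countable ?_ ?_
  · exact (Set.toFinite {x, y}).countable.mono fun z hz => by simpa using hz
  · intro z hz
    rcases ZFSet.mem_pair.1 hz with rfl | rfl <;> assumption

theorem countable_Iio_of_lt_omega_one {α : Ordinal.{0}} (hα : α < ω_ 1) :
    (Set.Iio α).Countable := by
  rw [← Cardinal.le_aleph0_iff_set_countable, Cardinal.mk_Iio_ordinal]
  have h : α.card < Cardinal.aleph 1 := by
    rw [← Cardinal.lt_ord, Cardinal.ord_aleph]; exact hα
  have h' : α.card ≤ Cardinal.aleph0 := by
    rwa [← Order.lt_succ_iff, Cardinal.succ_aleph0]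
  exact Cardinal.lift_le_aleph0.2 h'

theorem toZFSet_mem_HOmegaOne {α : Ordinal.{0}} (hα : α < ω_ 1) : α.toZFSet ∈ HOmegaOne := by
  induction α using WellFoundedLT.induction with
  | _ α ih =>
    refine mem_HOmegaOne_of_countable ?_ ?_
    · refine ((countable_Iio_of_lt_omega_one hα).image Ordinal.toZFSet).mono fun y hy => ?_
      obtain ⟨β, hβ, rfl⟩ := Ordinal.mem_toZFSet_iff.1 hy
      exact ⟨β, hβ, rfl⟩
    · intro y hy
      obtain ⟨β, hβ, rfl⟩ := Ordinal.mem_toZFSet_iff.1 hy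
      exact ih β hβ (hβ.trans hα)

theorem omega_add_lt_omega_one {α : Ordinal.{0}} (hα : α < ω_ 1) : ω + α < ω_ 1 :=
  Ordinal.isPrincipal_add_omega 1 Ordinal.omega0_lt_omega_one hα

/-- A copy of `β` outside `ω`. -/
noncomputable def tag (β : Ordinal.{0}) : ZFSet.{0} := (ω + β).toZFSet

theorem tag_injective : Function.Injective tag := fun _ _ h =>
  add_left_cancel (Ordinal.toZFSet_injective h)

theorem tag_ne_nat (β : Ordinal.{0}) (n : ℕ) : tag β ≠ (n : Ordinal.{0}).toZFSet := fun h =>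
  ((Ordinal.natCast_lt_omega0 n).trans_le (le_add_right le_rfl)).ne'
    (Ordinal.toZFSet_injective h)

theorem nat_toZFSet_injective : Function.Injective fun n : ℕ => (n : Ordinal.{0}).toZFSet :=
  fun _ _ h => Nat.cast_injective (Ordinal.toZFSet_injective h)

/-! ### Splitting families from the chain of models -/

/-- The formula `∃ p β, p ∈ q ∧ β ∈ p ∧ β ∈ T ∧ j ∈ p` in the free variables `j, q, T`. -/
def linkFormula : setLang.Formula ℕ :=
  FirstOrder.Language.BoundedFormula.ex (FirstOrder.Language.BoundedFormula.ex
    (let r : setLang.Relations 2 := SetRel.mem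
     let p : setLang.Term (ℕ ⊕ Fin 2) := .var (Sum.inr 0)
     let β : setLang.Term (ℕ ⊕ Fin 2) := .var (Sum.inr 1)
     let v : ℕ → setLang.Term (ℕ ⊕ Fin 2) := fun i => .var (Sum.inl i)
     r.boundedFormula₂ p (v 1) ⊓ (r.boundedFormula₂ β p ⊓
      (r.boundedFormula₂ β (v 2) ⊓ r.boundedFormula₂ (v 0) p))))

theorem realize_linkFormula {M : Set ZFSet.{0}} (v : ℕ → M) :
    linkFormula.Realize v ↔ ∃ p β : M, p.1 ∈ (v 1).1 ∧ β.1 ∈ p.1 ∧ β.1 ∈ (v 2).1 ∧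
      (v 0).1 ∈ p.1 := by
  simp only [linkFormula, FirstOrder.Language.Formula.Realize,
    FirstOrder.Language.BoundedFormula.realize_ex, FirstOrder.Language.BoundedFormula.realize_inf]
  rfl

/-- When q codes a function by unordered pairs {argument, value} and T is a set of arguments, this
puts the image of T into the model. Transitivity makes the formula mean the same inside M as
outside. -/
theorem exists_link {M : Set ZFSet.{0}} (ht : IsTransitiveSet M) (hM : ModelsZFWithoutPower M)
    {q T w : ZFSet.{0}} (hq : q ∈ M) (hT : T ∈ M) (hw : w ∈ M) :
    ∃ b ∈ M, ∀ x, x ∈ b ↔ x ∈ w ∧ ∃ p ∈ q, ∃ β ∈ p, β ∈ T ∧ x ∈ p := by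
  obtain ⟨b, hb⟩ := hM.separation linkFormula
    (fun i => if i = 1 then ⟨q, hq⟩ else ⟨T, hT⟩) ⟨w, hw⟩
  have hb' : ∀ x : M, x.1 ∈ b.1 ↔ x.1 ∈ w ∧ ∃ p ∈ q, ∃ β ∈ p, β ∈ T ∧ x.1 ∈ p := by
    intro x
    rw [hb x, realize_linkFormula]
    refine and_congr_right fun _ => ⟨?_, ?_⟩
    · rintro ⟨p, β, h1, h2, h3, h4⟩
      exact ⟨p, by simpa using h1, β, h2, by simpa using h3, by simpa using h4⟩
    · rintro ⟨p, h1, β, h2, h3, h4⟩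
      have hp := ht q hq p h1
      exact ⟨⟨p, hp⟩, ⟨β, ht p hp β h2⟩, by simpa using h1, h2, by simpa using h3,
        by simpa using h4⟩
  refine ⟨b, b.2, fun x => ⟨fun hx => (hb' ⟨x, ht _ b.2 x hx⟩).1 hx, fun hx => ?_⟩⟩
  exact (hb' ⟨x, ht _ hw x hx.1⟩).2 hx

theorem exists_level_of_mem {M : Set.Iio (ω_ 1 : Ordinal.{0}) → Set ZFSet.{0}}
    (hmono : Monotone M) (hunion : ⋃ ξ, M ξ = HOmegaOne) {x : ZFSet.{0}} (hx : x ∈ HOmegaOne) :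
    ∃ ξ, ∀ η, ξ ≤ η → x ∈ M η := by
  rw [← hunion] at hx
  obtain ⟨ξ, hξ⟩ := Set.mem_iUnion.1 hx
  exact ⟨ξ, fun η h => hmono h hξ⟩

/-- `S` splits `N`, for sets of natural numbers. -/
def SplitsNat (S N : Set ℕ) : Prop := (N ∩ S).Infinite ∧ (N \ S).Infinite

theorem splitsNat_of_splits {s b : ZFSet.{0}} (hb : b ⊆ ZFSet.omega) (h : Splits s b) :
    SplitsNat {n | (n : Ordinal.{0}).toZFSet ∈ s} {n | (n : Ordinal.{0}).toZFSet ∈ b} := by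
  constructor
  · intro hf
    refine h.1 ((hf.image fun n : ℕ => (n : Ordinal.{0}).toZFSet).subset ?_)
    intro x hx
    rw [Set.mem_ofPred_eq, ZFSet.mem_inter] at hx
    obtain ⟨n, rfl⟩ := mem_omega_iff.1 (hb hx.1)
    exact ⟨n, hx, rfl⟩
  · intro hf
    refine h.2 ((hf.image fun n : ℕ => (n : Ordinal.{0}).toZFSet).subset ?_)
    intro x hx
    rw [Set.mem_ofPred_eq, ZFSet.mem_sdiff] at hx
    obtain ⟨n, rfl⟩ := mem_omega_iff.1 (hb hx.1)
    exact ⟨n, hx, rfl⟩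

/-- At every countable level `α` there is a class of sequences of ordinals, such that every sequence
is in all classes from some level on, and every map into `ℕ` from the ordinals below `α` admits a
set splitting all infinite images of sequences in the class. -/
theorem exists_splitting_families (M : Set.Iio (ω_ 1 : Ordinal.{0}) → Set ZFSet.{0})
    (hmono : Monotone M) (hunion : ⋃ ξ, M ξ = HOmegaOne)
    (htrans : ∀ ξ, IsTransitiveSet (M ξ)) (hmodel : ∀ ξ, ModelsZFWithoutPower (M ξ))
    (hsplit : ∀ ξ, ∃ s : ZFSet.{0}, s ⊆ ZFSet.omega ∧
      ∀ b ∈ M ξ, b ⊆ ZFSet.omega → {n | n ∈ b}.Infinite → Splits s b) :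
    ∃ C : Ordinal.{0} → Set (ℕ → Ordinal.{0}),
      (∀ t : ℕ → Ordinal.{0}, (∀ n, t n < ω_ 1) → ∃ ξ < ω_ 1, ∀ η < ω_ 1, ξ ≤ η → t ∈ C η) ∧
      ∀ α < ω_ 1, ∀ N : Set ℕ, N.Infinite → ∀ J : Ordinal.{0} → ℕ, ∃ S : Set ℕ,
        SplitsNat S N ∧ ∀ t ∈ C α, (∀ n, t n < α) →
          (Set.range fun n => J (t n)).Infinite → SplitsNat S (Set.range fun n => J (t n)) := by
  -- Only the range of t needs to be coded, since only the image of that range under J is to be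
  -- split.
  refine ⟨fun α => {t | ∃ h : α < ω_ 1, ZFSet.range (fun n => tag (t n)) ∈ M ⟨α, h⟩}, ?_, ?_⟩
  · intro t ht
    obtain ⟨ξ, hξ⟩ := exists_level_of_mem hmono hunion (range_mem_HOmegaOne
      (f := fun n => tag (t n)) fun n => toZFSet_mem_HOmegaOne (omega_add_lt_omega_one (ht n)))
    exact ⟨ξ.1, ξ.2, fun η hη h => ⟨hη, hξ ⟨η, hη⟩ h⟩⟩
  · intro α hα N hN J
    have hnat : ∀ n : ℕ, (n : Ordinal.{0}).toZFSet ∈ HOmegaOne := fun n =>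
      toZFSet_mem_HOmegaOne ((Ordinal.natCast_lt_omega0 n).trans Ordinal.omega0_lt_omega_one)
    have hω : ZFSet.omega ∈ HOmegaOne := by
      refine mem_HOmegaOne_of_countable ?_ ?_
      · refine (Set.countable_range fun n : ℕ => (n : Ordinal.{0}).toZFSet).mono fun x hx => ?_
        exact mem_omega_iff.1 hx
      · intro y hy
        obtain ⟨n, rfl⟩ := mem_omega_iff.1 hy
        exact hnat n
    have hN' : ZFSet.range (fun n : N => ((n : ℕ) : Ordinal.{0}).toZFSet) ∈ HOmegaOne :=
      range_mem_HOmegaOne fun n => hnat n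
    have hq : ZFSet.range (fun β : Set.Iio α =>
        ({tag β, (J β : Ordinal.{0}).toZFSet} : ZFSet.{0})) ∈ HOmegaOne := by
      have hc := countable_Iio_of_lt_omega_one hα
      refine mem_HOmegaOne_of_countable ?_ ?_
      · refine (hc.image fun β => ({tag β, (J β : Ordinal.{0}).toZFSet} : ZFSet.{0})).mono ?_
        intro y hy
        obtain ⟨β, rfl⟩ := ZFSet.mem_range.1 hy
        exact ⟨β, β.2, rfl⟩
      · intro y hy
        obtain ⟨β, rfl⟩ := ZFSet.mem_range.1 hy
        exact pair_mem_HOmegaOne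
          (toZFSet_mem_HOmegaOne (omega_add_lt_omega_one (β.2.trans hα))) (hnat _)
    obtain ⟨ξ₁, h₁⟩ := exists_level_of_mem hmono hunion hω
    obtain ⟨ξ₂, h₂⟩ := exists_level_of_mem hmono hunion hN'
    obtain ⟨ξ₃, h₃⟩ := exists_level_of_mem hmono hunion hq
    -- J need not be coded in M_α, so the splitting set is taken for a later model containing ω, N
    -- and the graph of J.
    set ξ : Set.Iio (ω_ 1 : Ordinal.{0}) := ⟨α, hα⟩ ⊔ (ξ₁ ⊔ (ξ₂ ⊔ ξ₃)) with hξ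
    have e₀ : (⟨α, hα⟩ : Set.Iio (ω_ 1 : Ordinal.{0})) ≤ ξ := le_sup_left
    have e₁ : ξ₁ ≤ ξ := le_sup_left.trans le_sup_right
    have e₂ : ξ₂ ≤ ξ := (le_sup_left.trans le_sup_right).trans le_sup_right
    have e₃ : ξ₃ ≤ ξ := (le_sup_right.trans le_sup_right).trans le_sup_right
    obtain ⟨s, -, hs⟩ := hsplit ξ
    have main : ∀ b ∈ M ξ, ∀ B : Set ℕ, B.Infinite →
        (∀ x, x ∈ b ↔ ∃ n ∈ B, (n : Ordinal.{0}).toZFSet = x) →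
        SplitsNat {n | (n : Ordinal.{0}).toZFSet ∈ s} B := by
      intro b hb B hB hbB
      have hbω : b ⊆ ZFSet.omega := by
        intro x hx
        obtain ⟨n, -, hn⟩ := (hbB x).1 hx
        exact mem_omega_iff.2 ⟨n, hn⟩
      have hB' : {n : ℕ | (n : Ordinal.{0}).toZFSet ∈ b} = B := by
        ext n
        rw [Set.mem_ofPred_eq, hbB]
        constructor
        · rintro ⟨m, hm, h⟩
          exact nat_toZFSet_injective h ▸ hm
        · exact fun h => ⟨n, h, rfl⟩
      rw [← hB']
      refine splitsNat_of_splits hbω (hs b hb hbω ?_)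
      refine (hB.image nat_toZFSet_injective.injOn).mono ?_
      rintro _ ⟨n, hn, rfl⟩
      exact (hbB _).2 ⟨n, hn, rfl⟩
    refine ⟨{n | (n : Ordinal.{0}).toZFSet ∈ s}, ?_, ?_⟩
    · refine main _ (h₂ ξ e₂) N hN fun x => ?_
      rw [ZFSet.mem_range]
      exact ⟨fun ⟨n, hn⟩ => ⟨n, n.2, hn⟩, fun ⟨n, h, hn⟩ => ⟨⟨n, h⟩, hn⟩⟩
    · rintro t ⟨_, htC⟩ htα hinf
      obtain ⟨b, hb, hbx⟩ := exists_link (htrans ξ) (hmodel ξ) (h₃ ξ e₃) (hmono e₀ htC) (h₁ ξ e₁)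
      refine main b hb _ hinf fun x => ?_
      rw [hbx]
      constructor
      · rintro ⟨hxω, p, hp, β, hβp, hβT, hxp⟩
        obtain ⟨m, rfl⟩ := mem_omega_iff.1 hxω
        obtain ⟨γ, rfl⟩ := ZFSet.mem_range.1 hp
        obtain ⟨n, rfl⟩ := ZFSet.mem_range.1 hβT
        -- Tags are never natural numbers, so the two entries of an unordered pair cannot be
        -- confused.
        rcases ZFSet.mem_pair.1 hβp with h | h
        · rcases ZFSet.mem_pair.1 hxp with h' | h'
          · exact (tag_ne_nat _ _ h'.symm).elim
          · exact ⟨_, ⟨n, rfl⟩, by rw [h', ← tag_injective h]⟩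
        · exact (tag_ne_nat _ _ h).elim
      · rintro ⟨_, ⟨n, rfl⟩, rfl⟩
        refine ⟨mem_omega_iff.2 ⟨_, rfl⟩, _, ZFSet.mem_range.2 ⟨⟨t n, htα n⟩, rfl⟩, tag (t n),
          ?_, ZFSet.mem_range.2 ⟨n, rfl⟩, ?_⟩ <;> simp

/-! ### Ideals generated along a sequence -/

/-- `X` belongs to the ideal generated by the `a γ`, `γ < β`. -/
def Small (a : Ordinal.{0} → Set ℕ) (β : Ordinal.{0}) (X : Set ℕ) : Prop :=
  ∃ F : Finset Ordinal.{0}, (∀ γ ∈ F, γ < β) ∧ X ⊆ ⋃ γ ∈ F, a γ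

section Small

variable {a a' : Ordinal.{0} → Set ℕ} {α β γ : Ordinal.{0}} {X Y : Set ℕ}

theorem Small.mono (h : Small a β Y) (hXY : X ⊆ Y) : Small a β X :=
  let ⟨F, hF, hY⟩ := h
  ⟨F, hF, hXY.trans hY⟩

theorem Small.union (hX : Small a β X) (hY : Small a β Y) : Small a β (X ∪ Y) := by
  classical
  obtain ⟨F, hF, hX⟩ := hX
  obtain ⟨G, hG, hY⟩ := hY
  refine ⟨F ∪ G, fun γ hγ => (Finset.mem_union.1 hγ).elim (hF γ) (hG γ), ?_⟩
  rw [Finset.set_biUnion_union]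
  exact Set.union_subset_union hX hY

theorem small_empty (a : Ordinal.{0} → Set ℕ) (β : Ordinal.{0}) : Small a β ∅ :=
  ⟨∅, by simp, by simp⟩

theorem small_of_lt (h : γ < β) : Small a β (a γ) :=
  ⟨{γ}, by simpa using h, by simp⟩

theorem Small.biUnion {ι : Type*} (s : Finset ι) {f : ι → Set ℕ}
    (h : ∀ i ∈ s, Small a β (f i)) : Small a β (⋃ i ∈ s, f i) := by
  classical
  induction s using Finset.induction_on with
  | empty => simpa using small_empty a β
  | insert i s _ ih =>
    rw [Finset.set_biUnion_insert]
    exact (h i (Finset.mem_insert_self i s)).union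
      (ih fun j hj => h j (Finset.mem_insert_of_mem hj))

theorem Small.congr (h : Small a β X) (haa' : ∀ γ < β, a γ = a' γ) : Small a' β X := by
  obtain ⟨F, hF, hX⟩ := h
  refine ⟨F, hF, hX.trans ?_⟩
  exact Set.iUnion₂_mono fun γ hγ => (haa' γ (hF γ hγ)).subset

theorem Small.subset_of_forall (h : Small a β X) (hY : ∀ γ < β, a γ ⊆ Y) : X ⊆ Y := by
  obtain ⟨F, hF, hX⟩ := h
  exact hX.trans (Set.iUnion₂_subset fun γ hγ => hY γ (hF γ hγ))

theorem Small.of_succ (h : Small a (β + 1) X) : ∃ E, Small a β E ∧ X ⊆ E ∪ a β := by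
  classical
  obtain ⟨F, hF, hX⟩ := h
  refine ⟨⋃ γ ∈ F.erase β, a γ, ⟨F.erase β, fun γ hγ => ?_, subset_rfl⟩, hX.trans ?_⟩
  · exact lt_of_le_of_ne (Order.lt_add_one_iff.1 (hF γ (Finset.mem_of_mem_erase hγ)))
      (Finset.ne_of_mem_erase hγ)
  · refine Set.iUnion₂_subset fun γ hγ => ?_
    by_cases h : γ = β
    · exact h ▸ Set.subset_union_right
    · exact (Set.subset_iUnion₂ (s := fun γ _ => a γ) γ (Finset.mem_erase.2 ⟨h, hγ⟩)).trans
        Set.subset_union_left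

/-- Finitely many ordinals below a limit are bounded below it. With properness, this prevents the
ideal at a limit level from having a largest element. -/
theorem Small.exists_lt_of_isSuccLimit (h : Small a β X) (hβ : Order.IsSuccLimit β) :
    ∃ γ < β, Small a γ X := by
  obtain ⟨F, hF, hX⟩ := h
  refine ⟨F.sup fun γ => γ + 1, ?_, F, fun γ hγ => ?_, hX⟩
  · exact (Finset.sup_lt_iff (bot_lt_iff_ne_bot.2 hβ.ne_bot)).2
      fun γ hγ => hβ.add_one_lt (hF γ hγ)
  · exact (lt_add_one γ).trans_le (Finset.le_sup (f := fun γ => γ + 1) hγ)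

end Small

/-! ### Continuing a sequence by one step -/

/-- `X` is decided by the filter generated by `a β` and the complements of the earlier terms. -/
def Decides (a : Ordinal.{0} → Set ℕ) (β : Ordinal.{0}) (X : Set ℕ) : Prop :=
  Small a β (a β ∩ X) ∨ Small a β (a β ∩ Xᶜ)

theorem Decides.compl {a : Ordinal.{0} → Set ℕ} {β : Ordinal.{0}} {X : Set ℕ}
    (h : Decides a β X) : Decides a β Xᶜ := by
  rw [Decides, compl_compl]
  exact Or.symm h

/-- The terms of `a` below `α` form a coherent proper sequence, and if the ideal they generate has a
largest element then the complement of that element is infinite. -/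
structure IsGood (a : Ordinal.{0} → Set ℕ) (α : Ordinal.{0}) : Prop where
  coherent : ∀ γ < α, ∀ β < γ, Decides a β (a γ)
  proper : ∀ β < α, ¬ Small a β (a β)
  infinite : ∀ E, Small a α E → (∀ β < α, a β ⊆ E) → Eᶜ.Infinite

/-- The properties of the pair `A`, `Aᶜ` of sets continuing the sequence `a` at `α`. -/
structure IsStep (C : Ordinal.{0} → Set (ℕ → Ordinal.{0})) (α : Ordinal.{0})
    (a : Ordinal.{0} → Set ℕ) (A : Set ℕ) : Prop where
  decides : ∀ β < α, Decides a β A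
  proper : ¬ Small a α A
  proper_compl : ¬ Small a α Aᶜ
  infinite : ∀ E, Small a α E → (∀ β < α, a β ⊆ E ∪ A) → (E ∪ A)ᶜ.Infinite
  infinite_compl : ∀ E, Small a α E → (∀ β < α, a β ⊆ E ∪ Aᶜ) → (E ∪ Aᶜ)ᶜ.Infinite
  splits : (∀ E, Small a α E → ¬ ∀ β < α, a β ⊆ E) → ∀ t ∈ C α, (∀ n, t n < α) →
    (∀ γ < α, ∀ᶠ n in Filter.atTop, Small a (t n) (a (t n) ∩ a γ)) →
    (∃ᶠ n in Filter.atTop, Small a (t n) (a (t n) ∩ A)) ∧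
      ∃ᶠ n in Filter.atTop, Small a (t n) (a (t n) ∩ Aᶜ)

theorem IsStep.congr {C : Ordinal.{0} → Set (ℕ → Ordinal.{0})} {α : Ordinal.{0}}
    {a a' : Ordinal.{0} → Set ℕ} {A : Set ℕ} (h : IsStep C α a A) (haa' : ∀ β < α, a β = a' β) :
    IsStep C α a' A := by
  have s : ∀ β ≤ α, ∀ X, Small a' β X ↔ Small a β X := fun β hβ X =>
    ⟨fun hX => hX.congr fun γ hγ => (haa' γ (hγ.trans_le hβ)).symm,
      fun hX => hX.congr fun γ hγ => haa' γ (hγ.trans_le hβ)⟩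
  refine ⟨fun β hβ => ?_, ?_, ?_, fun E hE hc => ?_, fun E hE hc => ?_, fun hp t ht htα hc => ?_⟩
  · simpa only [Decides, s β hβ.le, haa' β hβ] using h.decides β hβ
  · exact fun h' => h.proper ((s α le_rfl _).1 h')
  · exact fun h' => h.proper_compl ((s α le_rfl _).1 h')
  · exact h.infinite E ((s α le_rfl _).1 hE) fun β hβ => haa' β hβ ▸ hc β hβ
  · exact h.infinite_compl E ((s α le_rfl _).1 hE) fun β hβ => haa' β hβ ▸ hc β hβ
  · have := h.splits (fun E hE hc => hp E ((s α le_rfl _).2 hE) fun β hβ => haa' β hβ ▸ hc β hβ)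
      t ht htα fun γ hγ => (hc γ hγ).mono fun n hn => by
        rwa [s _ (htα n).le, ← haa' _ (htα n), ← haa' γ hγ] at hn
    simpa only [s _ (htα _).le, haa' _ (htα _)] using this

/-- Halve the infinite complement of the largest element `E₀` into two infinite sets. One half is
disjoint from all terms, hence decided, and either half witnesses the infinity clause for the other.
The splitting clause is vacuous. -/
theorem exists_isStep_of_principal {C : Ordinal.{0} → Set (ℕ → Ordinal.{0})} {α : Ordinal.{0}}
    {a : Ordinal.{0} → Set ℕ} (h : IsGood a α) {E₀ : Set ℕ} (hE₀ : Small a α E₀)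
    (hE : ∀ β < α, a β ⊆ E₀) : ∃ A, IsStep C α a A := by
  have hinf := h.infinite E₀ hE₀ hE
  obtain ⟨A, B, hAB, hd, hcard⟩ := hinf.exists_union_disjoint_cardinal_eq_of_infinite
  have hfin : A.Finite ↔ B.Finite := by
    rw [← Cardinal.lt_aleph0_iff_set_finite, hcard, Cardinal.lt_aleph0_iff_set_finite]
  have hA : A.Infinite := fun hA => hinf (hAB ▸ hA.union (hfin.1 hA))
  have hB : B.Infinite := fun hB => hA (hfin.2 hB)
  have hAE : A ⊆ E₀ᶜ := hAB ▸ Set.subset_union_left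
  have hBE : B ⊆ E₀ᶜ := hAB ▸ Set.subset_union_right
  have hBA : B ⊆ Aᶜ := fun x hx hxA => Set.disjoint_left.1 hd hxA hx
  have hE' : ∀ E, Small a α E → E ⊆ E₀ := fun E hE' => hE'.subset_of_forall hE
  refine ⟨A, fun β hβ => Or.inl ?_, fun hs => ?_, fun hs => ?_, fun E hs _ => ?_, fun E hs _ => ?_,
    fun hp => (hp E₀ hE₀ hE).elim⟩
  · refine (small_empty a β).mono fun x hx => hAE hx.2 (hE β hβ hx.1)
  · obtain ⟨x, hx⟩ := hA.nonempty
    exact hAE hx (hE' _ hs hx)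
  · obtain ⟨x, hx⟩ := hB.nonempty
    exact hBE hx (hE' _ hs (hBA hx))
  · refine hB.mono fun x hx hxE => ?_
    exact hxE.elim (fun h => hBE hx (hE' E hs h)) (hBA hx)
  · refine hA.mono fun x hx hxE => ?_
    exact hxE.elim (fun h => hAE hx (hE' E hs h)) fun h => h hx

theorem exists_isStep {C : Ordinal.{0} → Set (ℕ → Ordinal.{0})} {α : Ordinal.{0}}
    {a : Ordinal.{0} → Set ℕ} (hα : (Set.Iio α).Countable)
    (hC : ∀ N : Set ℕ, N.Infinite → ∀ J : Ordinal.{0} → ℕ, ∃ S : Set ℕ,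
        SplitsNat S N ∧ ∀ t ∈ C α, (∀ n, t n < α) →
          (Set.range fun n => J (t n)).Infinite → SplitsNat S (Set.range fun n => J (t n)))
    (h : IsGood a α) : ∃ A, IsStep C α a A := by
  by_cases hp : ∃ E, Small a α E ∧ ∀ β < α, a β ⊆ E
  · obtain ⟨E, hE, hE'⟩ := hp
    exact exists_isStep_of_principal h hE hE'
  push Not at hp
  have hne : (Set.Iio α).Nonempty := by
    obtain ⟨β, hβ, -⟩ := hp ∅ (small_empty a α)
    exact ⟨β, hβ⟩
  obtain ⟨e, he⟩ := hα.exists_eq_range hne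
  have heα : ∀ k, e k < α := fun k => by
    have : e k ∈ Set.Iio α := he ▸ Set.mem_range_self k
    exact this
  set c : ℕ → Set ℕ := disjointed fun k => a (e k) with hc
  have hcsub : ∀ k, c k ⊆ a (e k) := disjointed_le _
  have hcd : ∀ {i j}, i ≠ j → Disjoint (c i) (c j) := fun hij => disjoint_disjointed _ hij
  -- every small set is disjoint from almost all `c k`
  have hsm : ∀ E, Small a α E → ∃ m, ∀ k, m < k → Disjoint (c k) E := by
    intro E hE
    obtain ⟨F, hF, hEF⟩ := hE
    have : ∃ m, ∀ γ ∈ F, ∃ k ≤ m, e k = γ := by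
      have hex : ∀ γ ∈ F, ∃ k, e k = γ := fun γ hγ => by
        have : γ ∈ Set.range e := he ▸ hF γ hγ
        exact this
      choose! f hf using hex
      exact ⟨F.sup f, fun γ hγ => ⟨f γ, Finset.le_sup hγ, hf γ hγ⟩⟩
    obtain ⟨m, hm⟩ := this
    refine ⟨m, fun k hk => Set.disjoint_left.2 fun x hx hxE => ?_⟩
    obtain ⟨γ, hγ, hxγ⟩ := Set.mem_iUnion₂.1 (hEF hxE)
    obtain ⟨i, hi, rfl⟩ := hm γ hγ
    rw [hc, disjointed_apply] at hx
    exact hx.2 (Finset.le_sup (f := fun k => a (e k)) (Finset.mem_Iio.2 (hi.trans_lt hk)) hxγ)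
  -- Otherwise finitely many terms would cover all of them, giving the ideal a largest element.
  have hN : {k | (c k).Nonempty}.Infinite := by
    intro hfin
    obtain ⟨β, hβ, hβE⟩ := hp (⋃ k ∈ hfin.toFinset, a (e k))
      (Small.biUnion _ fun k _ => small_of_lt (heα k))
    refine hβE fun x hx => ?_
    obtain ⟨k, rfl⟩ : β ∈ Set.range e := he ▸ hβ
    have hx' : x ∈ ⋃ k, c k := by
      rw [hc, iUnion_disjointed]
      exact Set.mem_iUnion.2 ⟨k, hx⟩
    obtain ⟨i, hi⟩ := Set.mem_iUnion.1 hx'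
    exact Set.mem_iUnion₂.2 ⟨i, hfin.mem_toFinset.2 ⟨x, hi⟩, hcsub i hi⟩
  have hJ : ∀ β < α, ∃ j, ¬ Small a β (a β ∩ a (e j)) := by
    intro β hβ
    obtain ⟨k, rfl⟩ : β ∈ Set.range e := he ▸ hβ
    exact ⟨k, by simpa using h.proper _ hβ⟩
  classical
  -- The least index of a term in the filter at β; by minimality this filter contains the piece c (J
  -- β). The value 0 is a default outside α.
  let J : Ordinal.{0} → ℕ := fun β => if hβ : β < α then Nat.find (hJ β hβ) else 0
  have hJ₁ : ∀ β < α, ¬ Small a β (a β ∩ a (e (J β))) := fun β hβ => by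
    simpa only [J, dif_pos hβ] using Nat.find_spec (hJ β hβ)
  have hJ₂ : ∀ β < α, ∀ i < J β, Small a β (a β ∩ a (e i)) := fun β hβ i hi => by
    simp only [J, dif_pos hβ] at hi
    exact not_not.1 (Nat.find_min (hJ β hβ) hi)
  have hdec : ∀ β < α, ∀ γ < α, Decides a β (a γ) := by
    intro β hβ γ hγ
    rcases lt_trichotomy β γ with hlt | rfl | hlt
    · exact h.coherent γ hγ β hlt
    · exact Or.inr (by simpa using small_empty a β)
    · exact Or.inl ((small_of_lt hlt).mono Set.inter_subset_right)
  have hJc : ∀ β < α, Small a β (a β ∩ (c (J β))ᶜ) := by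
    intro β hβ
    have h1 : Small a β (a β ∩ (a (e (J β)))ᶜ) :=
      (hdec β hβ _ (heα _)).resolve_left (hJ₁ β hβ)
    refine (h1.union (Small.biUnion (Finset.Iio (J β)) fun i hi =>
      hJ₂ β hβ i (Finset.mem_Iio.1 hi))).mono ?_
    rintro x ⟨hx, hxc⟩
    by_cases hxJ : x ∈ a (e (J β))
    · right
      rw [hc, disjointed_apply] at hxc
      have : x ∈ (Finset.Iio (J β)).sup fun k => a (e k) := by
        by_contra hx'
        exact hxc ⟨hxJ, hx'⟩
      rw [Finset.sup_set_eq_biUnion] at this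
      obtain ⟨i, hi, hxi⟩ := Set.mem_iUnion₂.1 this
      exact Set.mem_iUnion₂.2 ⟨i, hi, hx, hxi⟩
    · exact Or.inl ⟨hx, hxJ⟩
  -- Splitting the set of indices of nonempty pieces gives properness of A and Aᶜ; splitting the
  -- images under J gives the oscillation.
  obtain ⟨S, hSN, hST⟩ := hC _ hN J
  set A : Set ℕ := ⋃ k ∈ S, c k with hA
  have hcA : ∀ k ∈ S, c k ⊆ A := fun k hk => Set.subset_biUnion_of_mem (u := c) hk
  have hcA' : ∀ k ∉ S, c k ⊆ Aᶜ := fun k hk x hx hxA => by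
    obtain ⟨i, hi, hxi⟩ := Set.mem_iUnion₂.1 hxA
    exact Set.disjoint_left.1 (hcd fun hki : k = i => hk (hki ▸ hi)) hx hxi
  have hin : ∀ β < α, J β ∈ S → Small a β (a β ∩ Aᶜ) := fun β hβ hS =>
    (hJc β hβ).mono (Set.inter_subset_inter_right _ (Set.compl_subset_compl.2 (hcA _ hS)))
  have hout : ∀ β < α, J β ∉ S → Small a β (a β ∩ A) := fun β hβ hS =>
    (hJc β hβ).mono (Set.inter_subset_inter_right _ (Set.subset_compl_comm.1 (hcA' _ hS)))
  have hpick : ∀ E, Small a α E → (∃ k ∈ S, ∃ x ∈ c k, x ∉ E) ∧ ∃ k ∉ S, ∃ x ∈ c k, x ∉ E := by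
    intro E hE
    obtain ⟨m, hm⟩ := hsm E hE
    obtain ⟨k, ⟨⟨x, hx⟩, hkS⟩, hk⟩ := hSN.1.exists_gt m
    obtain ⟨l, ⟨⟨y, hy⟩, hlS⟩, hl⟩ := hSN.2.exists_gt m
    exact ⟨⟨k, hkS, x, hx, Set.disjoint_left.1 (hm k hk) hx⟩,
      l, hlS, y, hy, Set.disjoint_left.1 (hm l hl) hy⟩
  refine ⟨A, ?_, ?_, ?_, ?_, ?_, ?_⟩
  · intro β hβ
    by_cases hS : J β ∈ S
    · exact Or.inr (hin β hβ hS)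
    · exact Or.inl (hout β hβ hS)
  · intro hs
    obtain ⟨k, hk, x, hx, hxE⟩ := (hpick _ hs).1
    exact hxE (hcA k hk hx)
  · intro hs
    obtain ⟨k, hk, x, hx, hxE⟩ := (hpick _ hs).2
    exact hxE (hcA' k hk hx)
  -- The infinity clauses hold vacuously: some piece outside A is not contained in E, so E ∪ A does
  -- not cover the terms; likewise for Aᶜ.
  · intro E hE hcov
    obtain ⟨k, hk, x, hx, hxE⟩ := (hpick _ hE).2
    exact ((hcov _ (heα k) (hcsub k hx)).elim hxE (hcA' k hk hx)).elim
  · intro E hE hcov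
    obtain ⟨k, hk, x, hx, hxE⟩ := (hpick _ hE).1
    exact ((hcov _ (heα k) (hcsub k hx)).elim hxE fun h => h (hcA k hk hx)).elim
  · intro _ t ht htα hconv
    -- The filter at t n contains the term with index J (t n), whereas each fixed term is eventually
    -- omitted.
    have hJt : ∀ j, {n | J (t n) = j}.Finite := by
      intro j
      have := hconv _ (heα j)
      rw [← Nat.cofinite_eq_atTop, Filter.eventually_cofinite] at this
      refine this.subset fun n hn hs => ?_
      obtain rfl : J (t n) = j := hn
      exact hJ₁ _ (htα n) hs
    have hinf : (Set.range fun n => J (t n)).Infinite := by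
      intro hfin
      refine Set.infinite_univ (α := ℕ) ((hfin.biUnion fun j _ => hJt j).subset fun n _ => ?_)
      exact Set.mem_iUnion₂.2 ⟨J (t n), ⟨n, rfl⟩, rfl⟩
    obtain ⟨h1, h2⟩ := hST t ht htα hinf
    have hfr : ∀ P : ℕ → Prop, {j | j ∈ Set.range (fun n => J (t n)) ∧ P j}.Infinite →
        ∃ᶠ n in Filter.atTop, P (J (t n)) := by
      intro P hP
      rw [Nat.frequently_atTop_iff_infinite]
      intro hfin
      refine hP ((hfin.image fun n => J (t n)).subset ?_)
      rintro _ ⟨⟨n, rfl⟩, hn⟩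
      exact ⟨n, hn, rfl⟩
    exact ⟨(hfr (· ∉ S) h2).mono fun n hn => hout _ (htα n) hn,
      (hfr (· ∈ S) h1).mono fun n hn => hin _ (htα n) hn⟩

/-! ### Recursion along branches -/

/-- At every countable level `α`, every map into `ℕ` admits a set splitting all infinite images of
sequences in `C α`. -/
def HasSplitting (C : Ordinal.{0} → Set (ℕ → Ordinal.{0})) : Prop :=
  ∀ α < ω_ 1, ∀ N : Set ℕ, N.Infinite → ∀ J : Ordinal.{0} → ℕ, ∃ S : Set ℕ,
    SplitsNat S N ∧ ∀ t ∈ C α, (∀ n, t n < α) →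
      (Set.range fun n => J (t n)).Infinite → SplitsNat S (Set.range fun n => J (t n))

/-- A chosen set continuing the sequence `a` at `α`. -/
noncomputable def step (C : Ordinal.{0} → Set (ℕ → Ordinal.{0})) (α : Ordinal.{0})
    (a : Ordinal.{0} → Set ℕ) : Set ℕ :=
  Classical.epsilon (IsStep C α a)

/-- The sequence along the branch determined by `G`, which decides at each level between the chosen
set and its complement. -/
noncomputable def branchSeq (C : Ordinal.{0} → Set (ℕ → Ordinal.{0}))
    (G : Ordinal.{0} → Set ℕ → Bool) (α : Ordinal.{0}) : Set ℕ :=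
  let A := step C α fun β => if _h : β < α then branchSeq C G β else ∅
  bif G α A then A else Aᶜ
termination_by α

/-- The set chosen at level `α` of the branch determined by `G`. -/
noncomputable def branchStep (C : Ordinal.{0} → Set (ℕ → Ordinal.{0}))
    (G : Ordinal.{0} → Set ℕ → Bool) (α : Ordinal.{0}) : Set ℕ :=
  step C α fun β => if β < α then branchSeq C G β else ∅

section Branch

variable {C : Ordinal.{0} → Set (ℕ → Ordinal.{0})} {G G' : Ordinal.{0} → Set ℕ → Bool}
  {α : Ordinal.{0}}

theorem branchSeq_eq (C : Ordinal.{0} → Set (ℕ → Ordinal.{0})) (G : Ordinal.{0} → Set ℕ → Bool)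
    (α : Ordinal.{0}) : branchSeq C G α =
      bif G α (branchStep C G α) then branchStep C G α else (branchStep C G α)ᶜ := by
  rw [branchSeq]
  rfl

theorem branchSeq_eq_or (C : Ordinal.{0} → Set (ℕ → Ordinal.{0}))
    (G : Ordinal.{0} → Set ℕ → Bool) (α : Ordinal.{0}) :
    branchSeq C G α = branchStep C G α ∨ branchSeq C G α = (branchStep C G α)ᶜ := by
  rw [branchSeq_eq]
  cases G α (branchStep C G α) <;> simp

theorem branchStep_congr (h : ∀ β < α, branchSeq C G β = branchSeq C G' β) :
    branchStep C G α = branchStep C G' α := by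
  unfold branchStep
  congr 1
  funext β
  split_ifs with hβ
  · exact h β hβ
  · rfl

theorem branchSeq_congr
    (h : ∀ β ≤ α, G β (branchStep C G β) = G' β (branchStep C G β)) :
    branchSeq C G α = branchSeq C G' α := by
  induction α using WellFoundedLT.induction with
  | _ α ih =>
    have hs := branchStep_congr fun β hβ => ih β hβ fun γ hγ => h γ (hγ.trans hβ.le)
    rw [branchSeq_eq, branchSeq_eq, ← hs, h α le_rfl]

/-- At the first level of disagreement both branches face the same chosen set, so they can only
differ by taking it and its complement. -/
theorem exists_branchSeq_eq_compl (h : branchSeq C G α ≠ branchSeq C G' α) :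
    ∃ β ≤ α, (∀ γ < β, branchSeq C G γ = branchSeq C G' γ) ∧
      branchSeq C G β = (branchSeq C G' β)ᶜ := by
  induction α using WellFoundedLT.induction with
  | _ α ih =>
    by_cases hb : ∃ β < α, branchSeq C G β ≠ branchSeq C G' β
    · obtain ⟨β, hβ, hne⟩ := hb
      obtain ⟨γ, hγ, h'⟩ := ih β hβ hne
      exact ⟨γ, hγ.trans hβ.le, h'⟩
    · push Not at hb
      refine ⟨α, le_rfl, hb, ?_⟩
      have hs := branchStep_congr hb
      rw [branchSeq_eq C G, branchSeq_eq C G', hs] at h ⊢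
      revert h
      cases G α (branchStep C G' α) <;> cases G' α (branchStep C G' α) <;> simp

/-- The infinity clause depends on the type of α: at 0 the ideal is trivial, at a successor it is
the infinity clause of the last step, and at a limit a largest element would contradict properness.
-/
theorem isGood_of_isStep {a A : Ordinal.{0} → Set ℕ} (hA : ∀ β < α, IsStep C β a (A β))
    (ha : ∀ β < α, a β = A β ∨ a β = (A β)ᶜ) : IsGood a α := by
  have hproper : ∀ β < α, ¬ Small a β (a β) := fun β hβ => by
    rcases ha β hβ with h | h
    · exact fun hs => (hA β hβ).proper (h ▸ hs)
    · exact fun hs => (hA β hβ).proper_compl (h ▸ hs)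
  refine ⟨fun γ hγ β hβ => ?_, hproper, fun E hE hcov => ?_⟩
  · rcases ha γ hγ with h | h <;> rw [h]
    · exact (hA γ hγ).decides β hβ
    · exact ((hA γ hγ).decides β hβ).compl
  · rcases Ordinal.zero_or_succ_or_isSuccLimit α with rfl | ⟨β, rfl⟩ | hlim
    · obtain ⟨F, hF, hEF⟩ := hE
      have : E = ∅ := by
        refine Set.subset_empty_iff.1 (hEF.trans ?_)
        exact Set.iUnion₂_subset fun γ hγ => (not_lt_zero (hF γ hγ)).elim
      rw [this, Set.compl_empty]
      exact Set.infinite_univ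
    · have hβ : β < Order.succ β := Order.lt_succ β
      obtain ⟨E', hE', hEE'⟩ := Small.of_succ hE
      have hcov' : ∀ γ < β, a γ ⊆ E' ∪ a β := fun γ hγ => (hcov γ (hγ.trans hβ)).trans hEE'
      have : (E' ∪ a β)ᶜ.Infinite := by
        rcases ha β hβ with h | h <;> rw [h] at hcov' ⊢
        · exact (hA β hβ).infinite E' hE' hcov'
        · exact (hA β hβ).infinite_compl E' hE' hcov'
      exact this.mono (Set.compl_subset_compl.2 hEE')
    · obtain ⟨β, hβ, hs⟩ := hE.exists_lt_of_isSuccLimit hlim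
      exact (hproper β hβ (hs.mono (hcov β hβ))).elim

theorem isStep_branchStep (hC : HasSplitting C) (G : Ordinal.{0} → Set ℕ → Bool)
    (hα : α < ω_ 1) : IsStep C α (branchSeq C G) (branchStep C G α) := by
  induction α using WellFoundedLT.induction with
  | _ α ih =>
    have hgood : IsGood (branchSeq C G) α :=
      isGood_of_isStep (fun β hβ => ih β hβ (hβ.trans hα)) fun β _ => branchSeq_eq_or C G β
    obtain ⟨A, hA⟩ := exists_isStep (countable_Iio_of_lt_omega_one hα) (hC α hα) hgood
    have h : ∀ β < α, branchSeq C G β = if β < α then branchSeq C G β else ∅ :=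
      fun β hβ => (if_pos hβ).symm
    exact (Classical.epsilon_spec (p := IsStep C α fun β => if β < α then branchSeq C G β else ∅)
      ⟨A, hA.congr h⟩).congr fun β hβ => (h β hβ).symm

theorem decides_branchSeq (hC : HasSplitting C) (G : Ordinal.{0} → Set ℕ → Bool)
    {β : Ordinal.{0}} (hα : α < ω_ 1) : Decides (branchSeq C G) β (branchSeq C G α) := by
  rcases lt_trichotomy α β with h | rfl | h
  · exact Or.inl ((small_of_lt h).mono Set.inter_subset_right)
  · exact Or.inr (by simpa using small_empty _ α)
  · have := (isStep_branchStep hC G hα).decides β h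
    rcases branchSeq_eq_or C G α with h | h <;> rw [h]
    · exact this
    · exact this.compl

theorem not_small_branchSeq (hC : HasSplitting C) (G : Ordinal.{0} → Set ℕ → Bool)
    (hα : α < ω_ 1) : ¬ Small (branchSeq C G) α (branchSeq C G α) := by
  have := isStep_branchStep hC G hα
  rcases branchSeq_eq_or C G α with h | h <;> rw [h]
  · exact this.proper
  · exact this.proper_compl

end Branch

/-! ### The 𝕋-algebra on the full tree -/

/-- The extension of `σ` to all ordinals by the value `false`. -/
noncomputable def BinSeq.extend (σ : BinSeq) (i : Ordinal.{0}) : Bool :=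
  if h : i < σ.length then σ.val ⟨i, h⟩ else false

/-- The sets attached to the nodes of the tree. -/
def treeSet (C : Ordinal.{0} → Set (ℕ → Ordinal.{0})) (σ : BinSeq) : Set ℕ :=
  {n | ∃ α, σ.length = α + 1 ∧ n ∈ branchSeq C (fun i _ => σ.extend i) α}

section Tree

variable {C : Ordinal.{0} → Set (ℕ → Ordinal.{0})}

theorem treeSet_of_length_eq {σ : BinSeq} {α : Ordinal.{0}} (h : σ.length = α + 1) :
    treeSet C σ = branchSeq C (fun i _ => σ.extend i) α := by
  ext n
  constructor
  · rintro ⟨β, hβ, hn⟩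
    obtain rfl : α = β := Order.add_one_inj.1 (h.symm.trans hβ)
    exact hn
  · exact fun hn => ⟨α, h, hn⟩

theorem treeSet_eq_empty {σ : BinSeq} (h : ¬ ∃ α, σ.length = α + 1) : treeSet C σ = ∅ :=
  Set.eq_empty_of_forall_notMem fun _ ⟨α, hα, _⟩ => h ⟨α, hα⟩

theorem treeSet_restrict {x : BinSeq} {α : Ordinal.{0}} (h : α < x.length) :
    treeSet C (x.restrict (α + 1)) = branchSeq C (fun i _ => x.extend i) α := by
  have hl : (x.restrict (α + 1)).length = α + 1 := min_eq_left (Order.add_one_le_of_lt h)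
  rw [treeSet_of_length_eq hl]
  refine branchSeq_congr fun β hβ => ?_
  have h1 : β < (x.restrict (α + 1)).length := by
    rw [hl]
    exact Order.lt_add_one_iff.2 hβ
  simp only [BinSeq.extend, dif_pos h1, dif_pos (hβ.trans_lt h)]
  rfl

theorem treeSet_dagger {σ : BinSeq} {α : Ordinal.{0}} (h : σ.length = α + 1) :
    treeSet C σ.dagger = (treeSet C σ)ᶜ := by
  have hd : σ.dagger.length = α + 1 := h
  rw [treeSet_of_length_eq h, treeSet_of_length_eq hd]
  have hα : α < σ.length := h ▸ lt_add_one α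
  have hlt : ∀ β < α, σ.dagger.extend β = σ.extend β := fun β hβ => by
    have h1 : β < σ.length := hβ.trans hα
    have h2 : β < σ.dagger.length := h1
    have h3 : ¬ β + 1 = σ.length := fun h' =>
      hβ.ne (Order.add_one_inj.1 (h'.trans h))
    simp only [BinSeq.extend, dif_pos h1, dif_pos h2]
    simp only [BinSeq.dagger, if_neg h3]
  have heq : σ.dagger.extend α = !σ.extend α := by
    have h2 : α < σ.dagger.length := hα
    simp only [BinSeq.extend, dif_pos hα, dif_pos h2]
    simp only [BinSeq.dagger, if_pos h.symm]
  have hs : branchStep C (fun i _ => σ.dagger.extend i) α =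
      branchStep C (fun i _ => σ.extend i) α :=
    branchStep_congr fun β hβ => branchSeq_congr fun γ hγ => hlt γ (hγ.trans_lt hβ)
  rw [branchSeq_eq, branchSeq_eq, hs, heq]
  cases σ.extend α <;> simp

theorem isTAlgebra_treeSet (hC : HasSplitting C) : IsTAlgebra (tree (ω_ 1)) (treeSet C) := by
  refine ⟨ω_ 1, subset_rfl, fun σ hσ α _ => (min_le_right α σ.length).trans_lt hσ, fun σ hσ => hσ,
    fun σ _ h => treeSet_eq_empty h, fun σ _ ⟨α, hα⟩ => treeSet_dagger hα, fun x hx => ⟨?_, ?_⟩⟩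
  · rintro α ⟨hα, -⟩ β ⟨hβ, -⟩ hαβ
    rcases hαβ.eq_or_lt with rfl | hlt
    · exact ⟨∅, by simp, by simp⟩
    have key : ∀ X, Small (branchSeq C fun i _ => x.extend i) α X →
        Small (fun γ => treeSet C (x.restrict (γ + 1))) α X := fun X hX =>
      hX.congr fun γ hγ => (treeSet_restrict (hγ.trans hα)).symm
    have := decides_branchSeq hC (fun i _ => x.extend i) (β := α) (hβ.trans_le hx)
    simp only [treeSet_restrict hα, treeSet_restrict hβ]
    rcases this with h | h
    · obtain ⟨F, hF, hs⟩ := key _ h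
      exact ⟨F, hF, Or.inl hs⟩
    · obtain ⟨F, hF, hs⟩ := key _ h
      refine ⟨F, hF, Or.inr fun n hn => ?_⟩
      by_cases hnβ : n ∈ branchSeq C (fun i _ => x.extend i) β
      · exact Or.inl hnβ
      · exact Or.inr (hs ⟨hn, hnβ⟩)
  · rintro β ⟨hβ, -⟩ hs
    have hs' : Small (fun γ => treeSet C (x.restrict (γ + 1))) β
      (treeSet C (x.restrict (β + 1))) := hs
    rw [treeSet_restrict hβ] at hs'
    exact not_small_branchSeq hC (fun i _ => x.extend i) (hβ.trans_le hx)
      (hs'.congr fun γ hγ => treeSet_restrict (hγ.trans hβ))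

theorem branchSeq_mem (C : Ordinal.{0} → Set (ℕ → Ordinal.{0})) (G : Ordinal.{0} → Set ℕ → Bool)
    {α : Ordinal.{0}} (hα : α < ω_ 1) :
    branchSeq C G α ∈ generatedAlgebra (tree (ω_ 1)) (treeSet C) := by
  refine BooleanSubalgebra.subset_closure
    -- This node records the answers of G along its own branch.
    ⟨⟨α + 1, fun i => G i.1 (branchStep C G i.1)⟩, ?_, ?_⟩
  · exact (Cardinal.isSuccLimit_omega 1).add_one_lt hα
  · rw [treeSet_of_length_eq (α := α) rfl]
    refine (branchSeq_congr fun β hβ => ?_).symm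
    simp only [BinSeq.extend, dif_pos (Order.lt_add_one_iff.2 hβ)]

end Tree

/-! ### Ultrafilters and the branches they determine -/

/-- `X` belongs to the subalgebra `B` and to the ultrafilter `U` on `B`. -/
def Holds {B : BooleanSubalgebra (Set ℕ)} (U : StoneSpace B) (X : Set ℕ) : Prop :=
  ∃ h : X ∈ B, (⟨X, h⟩ : B) ∈ U.carrier

section Holds

variable {B : BooleanSubalgebra (Set ℕ)} {U V : StoneSpace B} {X Y : Set ℕ}

theorem Holds.mono (h : Holds U X) (hXY : X ⊆ Y) (hY : Y ∈ B) : Holds U Y :=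
  let ⟨_, hU⟩ := h
  ⟨hY, U.mem_of_le _ hU _ hXY⟩

theorem Holds.inter (hX : Holds U X) (hY : Holds U Y) : Holds U (X ∩ Y) :=
  let ⟨hXB, hXU⟩ := hX
  let ⟨hYB, hYU⟩ := hY
  ⟨B.infClosed hXB hYB, U.inf_mem _ hXU _ hYU⟩

theorem not_holds_empty : ¬ Holds U ∅ := fun ⟨_, h⟩ => U.bot_notMem h

theorem holds_compl_iff (hX : X ∈ B) : Holds U Xᶜ ↔ ¬ Holds U X := by
  refine ⟨fun hc h => not_holds_empty (by simpa using h.inter hc), fun h => ?_⟩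
  rcases U.mem_or_compl_mem ⟨X, hX⟩ with h' | h'
  · exact (h ⟨hX, h'⟩).elim
  · exact ⟨B.compl_mem hX, h'⟩

theorem holds_union_iff (hX : X ∈ B) (hY : Y ∈ B) :
    Holds U (X ∪ Y) ↔ Holds U X ∨ Holds U Y := by
  refine ⟨fun h => ?_, ?_⟩
  · by_contra! hn
    have := (((holds_compl_iff hX).2 hn.1).inter ((holds_compl_iff hY).2 hn.2)).inter h
    rw [← Set.compl_union, Set.compl_inter_self] at this
    exact not_holds_empty this
  · have hXY : X ∪ Y ∈ B := B.supClosed hX hY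
    rintro (h | h)
    · exact h.mono Set.subset_union_left hXY
    · exact h.mono Set.subset_union_right hXY

theorem not_holds_of_small {a : Ordinal.{0} → Set ℕ} {β : Ordinal.{0}}
    (haB : ∀ γ < β, a γ ∈ B) (ha : ∀ γ < β, ¬ Holds U (a γ)) (hX : Small a β X) :
    ¬ Holds U X := by
  classical
  obtain ⟨F, hF, hXF⟩ := hX
  suffices h : (⋃ γ ∈ F, a γ) ∈ B ∧ ¬ Holds U (⋃ γ ∈ F, a γ) from fun hX => h.2 (hX.mono hXF h.1)
  clear hXF
  induction F using Finset.induction_on with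
  | empty => simpa using ⟨B.bot_mem, not_holds_empty⟩
  | insert γ F _ ih =>
    obtain ⟨h1, h2⟩ := ih fun δ hδ => hF δ (Finset.mem_insert_of_mem hδ)
    have hγ := hF γ (Finset.mem_insert_self γ F)
    rw [Finset.set_biUnion_insert]
    refine ⟨B.supClosed (haB γ hγ) h1, ?_⟩
    rw [holds_union_iff (haB γ hγ) h1, not_or]
    exact ⟨ha γ hγ, h2⟩

theorem not_holds_of_small_inter {a : Ordinal.{0} → Set ℕ} {β : Ordinal.{0}}
    (haB : ∀ γ < β, a γ ∈ B) (ha : ∀ γ < β, ¬ Holds U (a γ)) (hβ : Holds U (a β))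
    (hX : Small a β (a β ∩ X)) : ¬ Holds U X := fun h =>
  not_holds_of_small haB ha hX (hβ.inter h)

theorem eq_of_holds_iff (h : ∀ X ∈ B, Holds U X ↔ Holds V X) : U = V := by
  have hc : U.carrier = V.carrier := by
    ext ⟨X, hX⟩
    exact ⟨fun hU => ((h X hX).1 ⟨hX, hU⟩).2, fun hV => ((h X hX).2 ⟨hX, hV⟩).2⟩
  cases U
  cases V
  congr

theorem eq_of_holds_iff_of_generators {Γ : Set BinSeq} {a : BinSeq → Set ℕ}
    {U V : StoneSpace (generatedAlgebra Γ a)} (h : ∀ σ ∈ Γ, Holds U (a σ) ↔ Holds V (a σ)) :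
    U = V := by
  refine eq_of_holds_iff fun X hX => ?_
  induction hX using BooleanSubalgebra.closure_bot_sup_induction with
  | mem X hX =>
    obtain ⟨σ, hσ, rfl⟩ := hX
    exact h σ hσ
  | bot => exact iff_of_false not_holds_empty not_holds_empty
  | sup X hX Y hY ihX ihY =>
    exact (holds_union_iff hX hY).trans ((or_congr ihX ihY).trans (holds_union_iff hX hY).symm)
  | compl X hX ih =>
    exact (holds_compl_iff hX).trans ((not_congr ih).trans (holds_compl_iff hX).symm)

theorem eventually_holds {u : ℕ → StoneSpace B} (hu : Filter.Tendsto u Filter.atTop (nhds U))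
    (h : Holds U X) : ∀ᶠ n in Filter.atTop, Holds (u n) X := by
  obtain ⟨hX, hU⟩ := h
  have hopen : IsOpen {W : StoneSpace B | (⟨X, hX⟩ : B) ∈ W.carrier} :=
    TopologicalSpace.isOpen_generateFrom_of_mem ⟨_, rfl⟩
  exact (hu.eventually (hopen.mem_nhds hU)).mono fun n hn => ⟨hX, hn⟩

/-- The branch of the tree determined by an ultrafilter: none of its sets is in the ultrafilter. -/
noncomputable def avoid (U : StoneSpace B) (_ : Ordinal.{0}) (A : Set ℕ) : Bool :=
  open Classical in decide (¬ Holds U A)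

theorem not_holds_branchSeq_avoid (C : Ordinal.{0} → Set (ℕ → Ordinal.{0})) (U : StoneSpace B)
    (α : Ordinal.{0}) : ¬ Holds U (branchSeq C (avoid U) α) := by
  rw [branchSeq_eq, avoid]
  by_cases h : Holds U (branchStep C (avoid U) α)
  · simpa [h] using fun hc => (holds_compl_iff h.1).1 hc h
  · simp [h]

end Holds

/-! ### No converging sequences in the Stone space -/

section Stone

variable {C : Ordinal.{0} → Set (ℕ → Ordinal.{0})}
  {U V : StoneSpace (generatedAlgebra (tree (ω_ 1)) (treeSet C))}

/-- Otherwise U would omit the whole branch of V. A node leaving that branch first does so at some β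
by a complement, which then lies in both ultrafilters while no earlier term does; coherence at β
forces U and V to agree on the set at that node. -/
theorem exists_holds_branchSeq_of_ne (hC : HasSplitting C) (hUV : U ≠ V) :
    ∃ β < ω_ 1, Holds U (branchSeq C (avoid V) β) ∧
      ∀ γ < β, ¬ Holds U (branchSeq C (avoid V) γ) := by
  by_contra! hn
  have heq : ∀ α < ω_ 1, branchSeq C (avoid U) α = branchSeq C (avoid V) α := by
    intro α hα
    by_contra hne
    obtain ⟨β, hβ, hlt, hc⟩ := exists_branchSeq_eq_compl hne
    have hβ1 := hβ.trans_lt hα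
    have hU := not_holds_branchSeq_avoid C U β
    rw [hc, holds_compl_iff (branchSeq_mem C _ hβ1), not_not] at hU
    obtain ⟨γ, hγ, h⟩ := hn β hβ1 hU
    exact not_holds_branchSeq_avoid C U γ (hlt γ hγ ▸ h)
  refine hUV (eq_of_holds_iff_of_generators fun σ hσ => ?_)
  by_cases hl : ∃ α, σ.length = α + 1
  swap
  · rw [treeSet_eq_empty hl]
    exact iff_of_false not_holds_empty not_holds_empty
  obtain ⟨α, hl⟩ := hl
  rw [treeSet_of_length_eq hl]
  have hα : α < ω_ 1 := (lt_add_one α).trans (hl ▸ hσ)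
  have hVU : ∀ γ < ω_ 1, ¬ Holds U (branchSeq C (avoid V) γ) := fun γ hγ =>
    heq γ hγ ▸ not_holds_branchSeq_avoid C U γ
  have hVV := not_holds_branchSeq_avoid C V
  set w := branchSeq C fun i _ => σ.extend i with hw
  by_cases hne : w α = branchSeq C (avoid V) α
  · rw [hne]
    exact iff_of_false (hVU α hα) (hVV α)
  obtain ⟨β, hβ, hlt, hc⟩ := exists_branchSeq_eq_compl hne
  have hβ1 := hβ.trans_lt hα
  have hwB : ∀ γ < β, w γ ∈ generatedAlgebra (tree (ω_ 1)) (treeSet C) := fun γ hγ =>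
    branchSeq_mem C _ (hγ.trans hβ1)
  have hαB : w α ∈ generatedAlgebra (tree (ω_ 1)) (treeSet C) := branchSeq_mem C _ hα
  have key : ∀ W : StoneSpace (generatedAlgebra (tree (ω_ 1)) (treeSet C)),
      (∀ γ < ω_ 1, ¬ Holds W (branchSeq C (avoid V) γ)) → ∀ X, Small w β (w β ∩ X) →
        ¬ Holds W X := by
    intro W hW X hX
    refine not_holds_of_small_inter hwB (fun γ hγ => ?_) ?_ hX
    · rw [hw, hlt γ hγ]
      exact hW γ (hγ.trans hβ1)
    · rw [hw, hc, holds_compl_iff (branchSeq_mem C _ hβ1)]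
      exact hW β hβ1
  rcases decides_branchSeq hC (fun i _ => σ.extend i) (β := β) hα with h | h
  · exact iff_of_false (key U hVU _ h) (key V (fun γ _ => hVV γ) _ h)
  · have h1 := key U hVU _ h
    have h2 := key V (fun γ _ => hVV γ) _ h
    rw [holds_compl_iff hαB, not_not] at h1 h2
    exact iff_of_true h1 h2

theorem not_tendsto_of_forall_ne (hC : HasSplitting C)
    (hC' : ∀ t : ℕ → Ordinal.{0}, (∀ n, t n < ω_ 1) → ∃ ξ < ω_ 1, ∀ η < ω_ 1, ξ ≤ η → t ∈ C η)
    {u : ℕ → StoneSpace (generatedAlgebra (tree (ω_ 1)) (treeSet C))} (hne : ∀ n, u n ≠ V) :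
    ¬ Filter.Tendsto u Filter.atTop (nhds V) := by
  intro hu
  choose t ht1 ht2 ht3 using fun n => exists_holds_branchSeq_of_ne hC (hne n)
  set z := branchSeq C (avoid V) with hz
  have hzB : ∀ γ < ω_ 1, z γ ∈ generatedAlgebra (tree (ω_ 1)) (treeSet C) := fun γ hγ =>
    branchSeq_mem C _ hγ
  have hsmall : ∀ n X, Small z (t n) (z (t n) ∩ X) → ¬ Holds (u n) X := fun n X hX =>
    not_holds_of_small_inter (fun γ hγ => hzB γ (hγ.trans (ht1 n))) (ht3 n) (ht2 n) hX
  obtain ⟨ξ, hξ, htC⟩ := hC' t ht1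
  have hsup : ⨆ n, t n < ω_ 1 := Ordinal.iSup_lt_omega_one ht1
  -- Adding ω makes δ a limit, so that the ideal at δ has no largest element and the splitting
  -- clause applies.
  set δ := max ξ (⨆ n, t n) + ω with hδ
  have hδ1 : δ < ω_ 1 :=
    Ordinal.isPrincipal_add_omega 1 (max_lt hξ hsup) Ordinal.omega0_lt_omega_one
  have hlim : Order.IsSuccLimit δ := Ordinal.isSuccLimit_add _ Ordinal.isSuccLimit_omega0
  have hmax : max ξ (⨆ n, t n) < δ := lt_add_of_pos_right _ Ordinal.omega0_pos
  have htδ : ∀ n, t n < δ := fun n =>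
    ((Ordinal.le_iSup t n).trans (le_max_right _ _)).trans_lt hmax
  have hstep := isStep_branchStep hC (avoid V) hδ1
  obtain ⟨h1, h2⟩ := hstep.splits
    (fun E hE hcov => by
      obtain ⟨γ, hγ, hs⟩ := hE.exists_lt_of_isSuccLimit hlim
      exact not_small_branchSeq hC _ (hγ.trans hδ1) (hs.mono (hcov γ hγ)))
    t (htC δ hδ1 ((le_max_left _ _).trans hmax.le)) htδ
    (fun γ hγ => by
      have hγ1 := hγ.trans hδ1
      have hc := (holds_compl_iff (hzB γ hγ1)).2 (not_holds_branchSeq_avoid C V γ)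
      refine (eventually_holds hu hc).mono fun n hn => ?_
      -- Convergence puts the complement of `z γ` in u n, so the decision made at t n must be
      -- against `z γ`.
      exact (decides_branchSeq hC (avoid V) hγ1).resolve_right fun hs => hsmall n _ hs hn)
  have hA : branchStep C (avoid V) δ ∈ generatedAlgebra (tree (ω_ 1)) (treeSet C) := by
    rcases branchSeq_eq_or C (avoid V) δ with h | h
    · exact h ▸ hzB δ hδ1
    · rw [← compl_compl (branchStep C (avoid V) δ), ← h]
      exact BooleanSubalgebra.compl_mem (hzB δ hδ1)
  by_cases hV : Holds V (branchStep C (avoid V) δ)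
  · obtain ⟨n, hn, hn'⟩ := (h1.and_eventually (eventually_holds hu hV)).exists
    exact hsmall n _ hn hn'
  · obtain ⟨n, hn, hn'⟩ :=
      (h2.and_eventually (eventually_holds hu ((holds_compl_iff hA).2 hV))).exists
    exact hsmall n _ hn hn'

theorem hasNoConvergingSequences_treeSet (hC : HasSplitting C)
    (hC' : ∀ t : ℕ → Ordinal.{0}, (∀ n, t n < ω_ 1) →
      ∃ ξ < ω_ 1, ∀ η < ω_ 1, ξ ≤ η → t ∈ C η) :
    HasNoConvergingSequences (StoneSpace (generatedAlgebra (tree (ω_ 1)) (treeSet C))) := by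
  intro u hinj V hu
  -- By injectivity the limit occurs at most once among the terms, so a tail avoids it.
  obtain ⟨N, hN⟩ : ∃ N, ∀ n, u (n + N) ≠ V := by
    by_cases h : ∃ m, u m = V
    · obtain ⟨m, rfl⟩ := h
      refine ⟨m + 1, fun n hn => ?_⟩
      have := hinj hn
      omega
    · push Not at h
      exact ⟨0, fun n => h n⟩
  exact not_tendsto_of_forall_ne hC hC' hN (hu.comp (Filter.tendsto_add_atTop_nat N))

end Stone

end TAlg

theorem mainTheorem6 (M : Set.Iio (ω_ 1 : Ordinal.{0}) → Set ZFSet.{0})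
    (hmono : Monotone M)
    (hunion : ⋃ ξ, M ξ = TAlg.HOmegaOne)
    (htrans : ∀ ξ, TAlg.IsTransitiveSet (M ξ))
    (hmodel : ∀ ξ, TAlg.ModelsZFWithoutPower (M ξ))
    (hsplit : ∀ ξ, ∃ s : ZFSet.{0}, s ⊆ ZFSet.omega ∧
      ∀ b ∈ M ξ, b ⊆ ZFSet.omega → {n | n ∈ b}.Infinite → TAlg.Splits s b) :
    ∃ a : TAlg.BinSeq → Set ℕ,
      TAlg.IsTAlgebra (TAlg.tree (ω_ 1)) a ∧
      TAlg.HasNoConvergingSequences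
        (TAlg.StoneSpace (TAlg.generatedAlgebra (TAlg.tree (ω_ 1)) a)) := by
  obtain ⟨C, hC', hC⟩ :=
    TAlg.exists_splitting_families M hmono hunion htrans hmodel hsplit
  exact ⟨TAlg.treeSet C, TAlg.isTAlgebra_treeSet hC, TAlg.hasNoConvergingSequences_treeSet hC hC'⟩
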